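/- **Theorem 2.4 (Forms for the Padé Approximants).** Let $M\ge 0$ be an integer, let $\omega_0,\dots,\omega_M$ be complex numbers no two of which (with different indices) differ by an integer, and let $\rho_0,\dots,\rho_M$ be nonnegative integers. Put $\sigma=\sum_{m=0}^M(\rho_m+1)$ and $\vec\rho\,!=\prod_{m=0}^M\rho_m!$; write $x^{\overline{n}}=x(x+1)\cdots(x+n-1)$ and $x^{\underline{n}}=x(x-1)\cdots(x-n+1)$ for the rising and falling factorials. The Padé approximants $H_0,\dots,H_M$ are the polynomials $H_m\in\mathbb C[z]$ of degree at most $\rho_m$ such that $$G(z)=\sum_{m=0}^M H_m(z)(1-z)^{\omega_m}$$ (principal branch) has a zero of order $\sigma-1$ at $z=0$ and $\lim_{z\to0}G(z)/z^{\sigma-1}=1/(\sigma-1)!$. They exist, are unique, and $H_m$ has degree exactly $\rho_m$. For each $0\le m\le M$ the following hold. (i) Let $\gamma_m$ be a simple positively oriented piecewise $C^1$ closed contour that encloses $\omega_m+r$ for $0\le r\le\rho_m$ and has all the points $\omega_k+r$ with $k\ne m$, $0\le r\le\rho_k$, in its exterior. Then for all complex $z\neq1$ $$H_m(z)=\frac{(-1)^{\sigma-1}}{2\pi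 i}\int_{\gamma_m}(1-z)^{\xi-\omega_m}\prod_{k=0}^M\frac{1}{(\xi-\omega_k)^{\underline{\rho_k+1}}}\,d\xi .$$ (ii) For all complex $z$, $$H_m(z)=\frac1{\rho_m!}\sum_{r=0}^{\rho_m}(z-1)^r\binom{\rho_m}{r}\prod_{k\ne m}\frac{1}{(\omega_k-\omega_m-r)^{\overline{\rho_k+1}}}.$$ (iii) If $M\ge1$, then for all complex $z$, $H_m(z)$ is the $M$-fold iterated integral $$H_m(z)=\frac{Q_m}{\vec\rho\,!}\int_{(G)}T_m^{-\omega_m-1}\Big(\prod_{k\ne m}t_k^{\omega_k}(1+t_k)^{\rho_k}\Big)\Big(1-(-1)^M\frac{1-z}{T_m}\Big)^{\rho_m}d\vec t,$$ where each $t_k=e^{i\theta_k}$ ($k\neq m$) runs counterclockwise over the unit circle from $\theta_k=-\pi$ to $\theta_k=\pi$, the integral over the variable with the smallest index being outermost, $Q_m=\prod_{k\ne m}\frac1{2i\sin(\pi(\omega_k-\omega_m))}$, $T_m=\prod_{k\neq m}t_k$, and powers are taken with these arguments: $t_k^{s}=e^{is\theta_k}$ and $T_m^{s}=\prod_{k\ne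 m}t_k^{s}$ for complex $s$. (iv) For all complex $z$, $$H_m(z)=\frac1{\rho_m!}\Big(\prod_{k\ne m}\frac1{(\omega_k-\omega_m)^{\overline{\rho_k+1}}}\Big)\;{}_{M+1}F_M\!\left(\begin{matrix}(\omega_m-\omega_k-\rho_k)_{0\le k\le M}\\(1+\omega_m-\omega_k)_{k\neq m}\end{matrix}\;\middle|\;1-z\right),$$ where ${}_pF_q(a;b\,|\,x)=\sum_{n\ge0}\frac{a_1^{\overline n}\cdots a_p^{\overline n}}{b_1^{\overline n}\cdots b_q^{\overline n}}\frac{x^n}{n!}$; the series terminates here, its terms with $n>\rho_m$ being $0$. (v) Put $W=\omega_k-\omega_m$ and $$C_{m,k,r}=\begin{cases}\binom{\rho_k}{r}& k=m,\\[2pt](-1)^{\rho_k+1}\binom{r}{\rho_k}^{-1}\dfrac{\Gamma(r+1)}{\Gamma(r+1-W)}\dfrac{\Gamma(r-\rho_k-W)}{\Gamma(r-\rho_k+1)}& k\ne m,\ \rho_k<r,\\[6pt](-1)^r\binom{\rho_k}{r}\dfrac{\Gamma(r+1)}{\Gamma(r+1-W)}\dfrac{\Gamma(\rho_k-r+1)}{\Gamma(\rho_k-r+1+W)}\dfrac{\pi}{\sin(\pi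 W)}& k\neq m,\ \rho_k\ge r.\end{cases}$$ Then for all complex $z$, $\;H_m(z)=\dfrac1{\vec\rho\,!}\displaystyle\sum_{r=0}^{\rho_m}(z-1)^r\prod_{k=0}^M C_{m,k,r}$. -/

import Mathlib

open Complex Filter Topology Polynomial
open scoped Nat Real

noncomputable section

namespace Pade

/-! ### Rising and falling factorials, generalized hypergeometric series -/

/-- The rising factorial `x (x + 1) ⋯ (x + r - 1)`. -/
def rising (x : ℂ) (r : ℕ) : ℂ := (ascPochhammer ℂ r).eval x

/-- The falling factorial `x (x - 1) ⋯ (x - r + 1)`. -/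
def falling (x : ℂ) (r : ℕ) : ℂ := (descPochhammer ℂ r).eval x

/-- The `n`-th term of the generalized hypergeometric series `ₚF_q(a; b; x)`. -/
def pFqTerm {p q : ℕ} (a : Fin p → ℂ) (b : Fin q → ℂ) (x : ℂ) (n : ℕ) : ℂ :=
  (∏ i, rising (a i) n) / (∏ j, rising (b j) n) * (x ^ n / (n ! : ℂ))

/-- The generalized hypergeometric function `ₚF_q(a; b; x)`, as the sum of its series. -/
def pFq {p q : ℕ} (a : Fin p → ℂ) (b : Fin q → ℂ) (x : ℂ) : ℂ :=
  ∑' n, pFqTerm a b x n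

/-! ### The Padé approximation problem for binomial functions -/

/-- `σ(ρ) = ∑ (ρ_m + 1)`. -/
def sigma {M : ℕ} (ρ : Fin (M + 1) → ℕ) : ℕ := ∑ m, (ρ m + 1)

/-- `ρ! = ∏ ρ_m!`. -/
def vecFactorial {M : ℕ} (ρ : Fin (M + 1) → ℕ) : ℕ := ∏ m, (ρ m)!

/-- The function `∑ H_m(z) (1 - z) ^ ω_m` (principal branch). -/
def remainder {M : ℕ} (ω : Fin (M + 1) → ℂ) (H : Fin (M + 1) → ℂ[X]) (z : ℂ) : ℂ :=
  ∑ m, (H m).eval z * (1 - z) ^ ω m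

/-- `H` is the system of Padé approximants with parameters `ω`, `ρ`: the degree of `H_m` is at
most `ρ_m`, and `G(z) = ∑ H_m(z) (1 - z) ^ ω_m` is analytic at `0`, has a zero of order
`σ - 1` there, and is normalized by `G(z) / z ^ (σ - 1) → 1 / (σ - 1)!`. -/
structure IsPadeSystem {M : ℕ} (ω : Fin (M + 1) → ℂ) (ρ : Fin (M + 1) → ℕ)
    (H : Fin (M + 1) → ℂ[X]) : Prop where
  natDegree_le : ∀ m, (H m).natDegree ≤ ρ m
  analyticAt : AnalyticAt ℂ (remainder ω H) 0
  order_eq : analyticOrderAt (remainder ω H) 0 = ((sigma ρ - 1 : ℕ) : ℕ∞)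
  tendsto : Tendsto (fun z : ℂ => remainder ω H z / z ^ (sigma ρ - 1)) (𝓝[≠] 0)
    (𝓝 (1 / ((sigma ρ - 1)! : ℂ)))

/-! ### Contours -/

/-- The contour integral `∫_γ f(ξ) dξ`. -/
def contourIntegral {a b : ℂ} (f : ℂ → ℂ) (γ : Path a b) : ℂ :=
  curveIntegral (fun ξ => ContinuousLinearMap.toSpanSingleton ℂ (f ξ)) γ

/-- A path is piecewise continuously differentiable if `[0, 1]` has a partition
`0 = τ 0 < τ 1 < ⋯ < τ n = 1` such that the path is `C¹` on each closed piece. -/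
def IsPiecewiseC1 {a b : ℂ} (γ : Path a b) : Prop :=
  ∃ (n : ℕ) (τ : ℕ → ℝ), τ 0 = 0 ∧ τ n = 1 ∧
    ∀ i < n, τ i < τ (i + 1) ∧ ContDiffOn ℝ 1 γ.extend (Set.Icc (τ i) (τ (i + 1)))

/-- The points enclosed by a closed path: those off the path whose connected component in the
complement of the path is bounded. -/
def inside {a : ℂ} (γ : Path a a) : Set ℂ :=
  {p | p ∉ Set.range γ ∧ Bornology.IsBounded (connectedComponentIn (Set.range γ)ᶜ p)}

/-- The points outside a closed path: those off the path whose connected component in the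
complement of the path is unbounded. -/
def outside {a : ℂ} (γ : Path a a) : Set ℂ :=
  {p | p ∉ Set.range γ ∧ ¬ Bornology.IsBounded (connectedComponentIn (Set.range γ)ᶜ p)}

/-- A simple positively oriented contour: a piecewise `C¹` closed path without
self-intersections (other than the common endpoint) that winds once counterclockwise around
each of the points it encloses. -/
structure IsSimplePositiveContour {a : ℂ} (γ : Path a a) : Prop where
  piecewiseC1 : IsPiecewiseC1 γ
  simple : Set.InjOn γ {t | t ≠ 1}
  positive : ∀ p ∈ inside γ, contourIntegral (fun ξ => 1 / (ξ - p)) γ = 2 * π * I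

/-! ### Iterated integrals over unit circles -/

/-- `∫_{|t| = 1} f(t) dt`, taken counterclockwise from angle `-π` to angle `π`. -/
def unitCircleIntegral (f : ℂ → ℂ) : ℂ :=
  ∫ θ in (-π)..π, f (exp (θ * I)) * (I * exp (θ * I))

/-- The `n`-fold iterated integral of `f(t_0, …, t_{n-1})` over unit circles, the integral over
`t_0` being the outermost one. -/
def iteratedCircleIntegral : (n : ℕ) → ((Fin n → ℂ) → ℂ) → ℂ
  | 0, f => f Fin.elim0
  | n + 1, f => unitCircleIntegral fun t =>
      iteratedCircleIntegral n fun v => f (Fin.cons t v)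

/-- The integrand of the iterated integral for `H_m(z)`. The variables `t_k`, `k ≠ m`, are
numbered by `Fin M`, so that `t j` stands for `t_k` with `k = m.succAbove j`. A complex power of
`T_m = ∏ t_k` is the product of the principal powers of the `t_k`, that is, it is computed with
the argument of `T_m` that is the sum of the principal arguments of the `t_k`. -/
def circleIntegrand {M : ℕ} (ω : Fin (M + 1) → ℂ) (ρ : Fin (M + 1) → ℕ) (m : Fin (M + 1))
    (z : ℂ) (t : Fin M → ℂ) : ℂ :=
  (∏ j, t j ^ (-ω m - 1)) *
    (∏ j, t j ^ ω (m.succAbove j) * (1 + t j) ^ ρ (m.succAbove j)) *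
    (1 - (-1) ^ M * ((1 - z) / ∏ j, t j)) ^ ρ m

/-- `Q_m = ∏_{k ≠ m} 1 / (2 i sin(π (ω_k - ω_m)))`. -/
def Q {M : ℕ} (ω : Fin (M + 1) → ℂ) (m : Fin (M + 1)) : ℂ :=
  ∏ k ∈ Finset.univ.erase m, 1 / (2 * I * sin (π * (ω k - ω m)))

/-! ### The coefficients with Gamma-function ratios -/

/-- The coefficients `C_{m,k,r}`, with `W = ω_k - ω_m`. -/
def gammaCoeff {M : ℕ} (ω : Fin (M + 1) → ℂ) (ρ : Fin (M + 1) → ℕ) (m k : Fin (M + 1))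
    (r : ℕ) : ℂ :=
  let W : ℂ := ω k - ω m
  if m = k then ((ρ k).choose r : ℂ)
  else if ρ k < r then
    (-1) ^ (ρ k + 1) * ((r.choose (ρ k) : ℂ))⁻¹ * (Gamma (r + 1) / Gamma (r + 1 - W)) *
      (Gamma (r - ρ k - W) / Gamma (r - ρ k + 1))
  else
    (-1) ^ r * ((ρ k).choose r : ℂ) * (Gamma (r + 1) / Gamma (r + 1 - W)) *
      (Gamma (ρ k - r + 1) / Gamma (ρ k - r + 1 + W)) * (π / sin (π * W))

end Pade

end

/-!
Write `x_i = ω_m + r`, `i = (m, r)`, for the `σ` exponents; the hypothesis on `ω` makes them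
distinct. Expanding `H_m` in powers of `1 - z`, the remainder near `0` is a sum
`∑ c_i (1 - z) ^ x_i`, whose `n`-th derivative at `0` is `(-1) ^ n ∑ c_i x_i (x_i - 1) ⋯ (x_i - n + 1)`
(`iteratedDeriv_sum_one_sub_cpow`). So the Padé conditions say that the functional
`P ↦ ∑ c_i P(x_i)` on polynomials of degree less than `σ` is, up to the sign `(-1) ^ (σ - 1)`, the
coefficient of degree `σ - 1`. The divided difference at the `x_i` is such a functional, with the
Lagrange nodal weights `∏_{j ≠ i} (x_i - x_j)⁻¹` as coefficients (`isPadeSystem_padeCoeff`), and it is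
the only one, as testing on the Lagrange basis shows (`IsPadeSystem.eq`).

Everything else is a computation with these weights. Splitting the product over `j ≠ i` gives the
Pochhammer form (`padeCoeff_eq`, `eval_padePoly`), from which the hypergeometric form and the form
with Gamma functions follow by elementary identities for `Γ` and rising factorials
(`one_div_rising_sub`, `gammaCoeff_eq`). In the contour integral, the product of reciprocals of
falling factorials is `∑ w_i / (ξ - x_i)`, with `w_i` the nodal weights (`prod_one_div_falling`), so
one needs Cauchy's formula for an entire numerator, and the vanishing of the winding integral around
points of the unbounded component (`IsPiecewiseC1.winding_eq_zero_of_mem_outside`): it is locally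
constant, and zero far away. Both use only the fundamental theorem of calculus for piecewise `C¹`
paths, applied to explicit logarithms and to a primitive of an entire function. In the iterated circle
integral, expanding the binomial power turns the integrand into a finite sum of products of functions
of one variable, and each one-variable integral is, up to a sine, the partial fraction sum
`∑ (-1) ^ j binom(ρ, j) / (x + j)` (`unitCircleIntegral_circleFactor`, `sum_choose_mul_one_div`).
-/

namespace Pade

/-! ### Sums of powers of `1 - z` -/

lemma one_sub_mem_slitPlane_eventually : ∀ᶠ z : ℂ in 𝓝 0, 1 - z ∈ slitPlane :=
  (continuous_const.sub continuous_id).continuousAt.eventually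
    (isOpen_slitPlane.mem_nhds (by simp))

lemma analyticAt_one_sub_cpow (s : ℂ) : AnalyticAt ℂ (fun z : ℂ => (1 - z) ^ s) 0 := by
  refine AnalyticAt.cpow (by fun_prop) (by fun_prop) (by simp)

lemma iteratedDeriv_one_sub_cpow (s : ℂ) (n : ℕ) {z : ℂ} (hz : 1 - z ∈ slitPlane) :
    iteratedDeriv n (fun z : ℂ => (1 - z) ^ s) z = (-1) ^ n * falling s n * (1 - z) ^ (s - n) := by
  induction n generalizing z with
  | zero => simp [falling]
  | succ n ih =>
    have hev : iteratedDeriv n (fun z : ℂ => (1 - z) ^ s) =ᶠ[𝓝 z]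
        fun z => (-1) ^ n * falling s n * (1 - z) ^ (s - n) := by
      filter_upwards [(continuous_const.sub continuous_id).continuousAt.eventually
        (isOpen_slitPlane.mem_nhds hz)] with w hw using ih hw
    have hd : HasDerivAt (fun z : ℂ => (1 - z) ^ (s - n))
        ((s - n) * (1 - z) ^ (s - n - 1) * (-1)) z :=
      ((hasDerivAt_id z).const_sub 1).cpow_const hz
    rw [iteratedDeriv_succ, hev.deriv_eq, (hd.const_mul _).deriv, falling, falling,
      descPochhammer_succ_eval]
    push_cast
    rw [sub_sub]
    ring

lemma iteratedDeriv_sum_one_sub_cpow {ι : Type*} [Fintype ι] (c x : ι → ℂ) (n : ℕ) :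
    iteratedDeriv n (fun z : ℂ => ∑ i, c i * (1 - z) ^ x i) 0 =
      (-1) ^ n * ∑ i, c i * falling (x i) n := by
  have hc : ∀ i ∈ Finset.univ, ContDiffAt ℂ n (fun z : ℂ => c i * (1 - z) ^ x i) 0 :=
    fun i _ => (analyticAt_const.fun_mul (analyticAt_one_sub_cpow (x i))).contDiffAt
  rw [iteratedDeriv_fun_sum hc, Finset.mul_sum]
  refine Finset.sum_congr rfl fun i _ => ?_
  rw [iteratedDeriv_const_mul_field, iteratedDeriv_one_sub_cpow _ _ (by simp)]
  simp
  ring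

lemma analyticAt_sum_one_sub_cpow {ι : Type*} [Fintype ι] (c x : ι → ℂ) :
    AnalyticAt ℂ (fun z : ℂ => ∑ i, c i * (1 - z) ^ x i) 0 :=
  Finset.analyticAt_fun_sum _ fun i _ => analyticAt_const.mul (analyticAt_one_sub_cpow (x i))

/-- A functional `P ↦ ∑ c i * P (x i)` that kills the falling factorials of degree less than `N`
kills all polynomials of degree less than `N`. -/
lemma sum_mul_eval_eq_zero {ι : Type*} [Fintype ι] {c x : ι → ℂ} {N : ℕ}
    (h : ∀ n < N, ∑ i, c i * falling (x i) n = 0) (P : ℂ[X]) (hP : P.degree < N) :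
    ∑ i, c i * P.eval (x i) = 0 := by
  induction N generalizing P with
  | zero =>
    have : P = 0 := by
      rw [← degree_eq_bot]
      simpa [Nat.WithBot.lt_zero_iff] using hP
    simp [this]
  | succ n ih =>
    have hn : (descPochhammer ℂ n).natDegree = n := descPochhammer_natDegree ℂ n
    have hm := monic_descPochhammer ℂ n
    have hlt : (P - C (P.coeff n) * descPochhammer ℂ n).degree < n := by
      rw [degree_lt_iff_coeff_zero]
      intro k hk
      rcases hk.eq_or_lt with rfl | hk
      · have h1 : (descPochhammer ℂ n).coeff n = 1 := by
          simpa [Monic, leadingCoeff, hn] using hm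
        simp [h1]
      · rw [coeff_sub, coeff_C_mul, coeff_eq_zero_of_natDegree_lt (p := descPochhammer ℂ n)
          (by omega), coeff_eq_zero_of_degree_lt (hP.trans_le (by exact_mod_cast hk))]
        simp
    have h2 := ih (fun k hk => h k (hk.trans n.lt_succ_self)) _ hlt
    have h3 := h n n.lt_succ_self
    simp only [eval_sub, eval_mul, eval_C, mul_sub, Finset.sum_sub_distrib] at h2
    rw [sub_eq_zero] at h2
    rw [h2]
    calc ∑ i, c i * (P.coeff n * (descPochhammer ℂ n).eval (x i))
        = P.coeff n * ∑ i, c i * falling (x i) n := by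
          rw [Finset.mul_sum]
          exact Finset.sum_congr rfl fun i _ => by rw [falling]; ring
      _ = 0 := by rw [h3, mul_zero]

/-- A sum of powers of `1 - z` with as many distinct exponents as its order of vanishing at `0`
is trivial. -/
lemma coeff_eq_zero_of_card_le_order {ι : Type*} [Fintype ι] {c x : ι → ℂ}
    (hx : Function.Injective x)
    (h : (Fintype.card ι : ℕ∞) ≤ analyticOrderAt (fun z : ℂ => ∑ i, c i * (1 - z) ^ x i) 0)
    (i : ι) : c i = 0 := by
  classical
  rw [natCast_le_analyticOrderAt_iff_iteratedDeriv_eq_zero (analyticAt_sum_one_sub_cpow c x)] at h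
  have h0 : ∀ n < Fintype.card ι, ∑ i, c i * falling (x i) n = 0 := by
    intro n hn
    have := h n hn
    rw [iteratedDeriv_sum_one_sub_cpow] at this
    simpa using this
  have hi := Finset.mem_univ i
  have hd : (Lagrange.basis Finset.univ x i).degree < (Fintype.card ι : ℕ) := by
    rw [Lagrange.degree_basis hx.injOn hi, Finset.card_univ, Nat.cast_lt]
    exact Nat.sub_lt (Fintype.card_pos_iff.mpr ⟨i⟩) one_pos
  have := sum_mul_eval_eq_zero h0 _ hd
  rw [Finset.sum_eq_single i] at this
  · simpa [Lagrange.eval_basis_self hx.injOn hi] using this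
  · intro j _ hj
    rw [Lagrange.eval_basis_of_ne hj.symm (Finset.mem_univ j), mul_zero]
  · simp

/-! ### Existence and uniqueness of the Padé approximants -/

/-- The exponents `ω_m + r`, `0 ≤ r ≤ ρ_m`, that occur in the remainder. -/
noncomputable def node {M : ℕ} (ω : Fin (M + 1) → ℂ) (ρ : Fin (M + 1) → ℕ)
    (i : Σ m, Fin (ρ m + 1)) : ℂ := ω i.1 + (i.2 : ℕ)

/-- The coefficients of the Padé approximants in powers of `1 - z`: up to a common sign they are
the nodal weights `∏_{j ≠ i} (x_i - x_j)⁻¹` of Lagrange interpolation at the exponents. -/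
noncomputable def padeCoeff {M : ℕ} (ω : Fin (M + 1) → ℂ) (ρ : Fin (M + 1) → ℕ)
    (i : Σ m, Fin (ρ m + 1)) : ℂ :=
  (-1) ^ (sigma ρ - 1) * Lagrange.nodalWeight Finset.univ (node ω ρ) i

/-- The system of polynomials whose `m`-th member is `∑ r, c (m, r) * (1 - X) ^ r`. -/
noncomputable def polySystem {M : ℕ} {ρ : Fin (M + 1) → ℕ} (c : (Σ m, Fin (ρ m + 1)) → ℂ)
    (m : Fin (M + 1)) : ℂ[X] :=
  ∑ r : Fin (ρ m + 1), C (c ⟨m, r⟩) * (1 - X) ^ (r : ℕ)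

variable {M : ℕ} {ω : Fin (M + 1) → ℂ} {ρ : Fin (M + 1) → ℕ}

lemma node_injective (hω : ∀ i j, i ≠ j → ∀ n : ℤ, ω i - ω j ≠ (n : ℂ)) :
    Function.Injective (node ω ρ) := by
  rintro ⟨m, r⟩ ⟨k, s⟩ h
  simp only [node] at h
  by_cases hmk : m = k
  · subst hmk
    have : (r : ℕ) = s := by exact_mod_cast add_left_cancel h
    rw [Fin.ext this]
  · refine absurd ?_ (hω m k hmk ((s : ℕ) - (r : ℕ) : ℤ))
    push_cast
    linear_combination h

lemma card_exponents (ρ : Fin (M + 1) → ℕ) : Fintype.card (Σ m, Fin (ρ m + 1)) = sigma ρ := by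
  simp [sigma]

lemma sigma_pos (ρ : Fin (M + 1) → ℕ) : 0 < sigma ρ := by
  rw [← card_exponents]
  exact Fintype.card_pos_iff.mpr ⟨⟨0, 0⟩⟩

lemma eval_polySystem (c : (Σ m, Fin (ρ m + 1)) → ℂ) (m : Fin (M + 1)) (z : ℂ) :
    (polySystem c m).eval z = ∑ r : Fin (ρ m + 1), c ⟨m, r⟩ * (1 - z) ^ (r : ℕ) := by
  simp [polySystem, eval_finsetSum]

lemma natDegree_polySystem_le (c : (Σ m, Fin (ρ m + 1)) → ℂ) (m : Fin (M + 1)) :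
    (polySystem c m).natDegree ≤ ρ m := by
  refine natDegree_sum_le_of_forall_le _ _ fun r _ => ?_
  refine (natDegree_C_mul_le _ _).trans ((natDegree_pow_le).trans ?_)
  have h1 : (1 - X : ℂ[X]).natDegree ≤ 1 := by compute_degree
  calc (r : ℕ) * (1 - X : ℂ[X]).natDegree ≤ r * 1 := by gcongr
    _ ≤ ρ m := by omega

/-- Every system of polynomials within the degree bounds has an expansion in powers of
`1 - X`. -/
lemma exists_eq_polySystem {H : Fin (M + 1) → ℂ[X]} (hH : ∀ m, (H m).natDegree ≤ ρ m) :
    ∃ c : (Σ m, Fin (ρ m + 1)) → ℂ, H = polySystem c := by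
  refine ⟨fun i => (-1) ^ (i.2 : ℕ) * (taylor 1 (H i.1)).coeff i.2, funext fun m => ?_⟩
  conv_lhs => rw [← sum_taylor_eq (H m) 1]
  rw [sum_over_range' _ (by simp) (ρ m + 1) (by rw [natDegree_taylor]; have := hH m; omega),
    Finset.sum_range, polySystem]
  refine Finset.sum_congr rfl fun r _ => ?_
  rw [show (1 - X : ℂ[X]) = C (-1) * (X - C 1) by simp, mul_pow, ← C_pow, ← mul_assoc, ← C_mul]
  congr 2
  rw [mul_right_comm, ← mul_pow]
  simp

lemma remainder_polySystem (c : (Σ m, Fin (ρ m + 1)) → ℂ) :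
    remainder ω (polySystem c) =ᶠ[𝓝 0] fun z => ∑ i, c i * (1 - z) ^ node ω ρ i := by
  filter_upwards [one_sub_mem_slitPlane_eventually] with z hz
  rw [remainder, Fintype.sum_sigma]
  refine Finset.sum_congr rfl fun m _ => ?_
  rw [eval_polySystem, Finset.sum_mul]
  refine Finset.sum_congr rfl fun r _ => ?_
  rw [node, cpow_add _ _ (slitPlane_ne_zero hz), cpow_natCast]
  ring

/-- The functional `P ↦ ∑ padeCoeff i * P (x i)` is, up to a sign, the divided difference at all
the exponents, so it extracts the coefficient of degree `σ - 1`. -/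
lemma sum_padeCoeff_mul_eval (hω : ∀ i j, i ≠ j → ∀ n : ℤ, ω i - ω j ≠ (n : ℂ))
    (P : ℂ[X]) (hP : P.degree < sigma ρ) :
    ∑ i, padeCoeff ω ρ i * P.eval (node ω ρ i) = (-1) ^ (sigma ρ - 1) * P.coeff (sigma ρ - 1) := by
  have hcard : (Finset.univ : Finset (Σ m, Fin (ρ m + 1))).card = sigma ρ := by
    rw [Finset.card_univ, card_exponents]
  have h := Lagrange.coeff_eq_sum (s := Finset.univ) (v := node ω ρ)
    (node_injective hω).injOn (P := P) (by rwa [hcard])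
  rw [hcard] at h
  rw [h, Finset.mul_sum]
  refine Finset.sum_congr rfl fun i _ => ?_
  rw [padeCoeff, Lagrange.nodalWeight, Finset.prod_inv_distrib]
  ring

lemma sum_padeCoeff_mul_falling (hω : ∀ i j, i ≠ j → ∀ n : ℤ, ω i - ω j ≠ (n : ℂ))
    {n : ℕ} (hn : n < sigma ρ) :
    (-1) ^ n * ∑ i, padeCoeff ω ρ i * falling (node ω ρ i) n =
      if n = sigma ρ - 1 then 1 else 0 := by
  have hd : (descPochhammer ℂ n).natDegree = n := descPochhammer_natDegree ℂ n
  have hm := monic_descPochhammer ℂ n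
  have h := sum_padeCoeff_mul_eval hω (descPochhammer ℂ n)
    (by rw [degree_eq_natDegree hm.ne_zero, hd]; exact_mod_cast hn)
  simp only [falling]
  rw [h]
  split_ifs with hs
  · have h1 : (descPochhammer ℂ n).coeff n = 1 := by
      simpa [Monic, leadingCoeff, hd] using hm
    rw [← hs, h1, mul_one, ← mul_pow]
    simp
  · rw [coeff_eq_zero_of_natDegree_lt (by omega)]
    simp

lemma isPadeSystem_padeCoeff (hω : ∀ i j, i ≠ j → ∀ n : ℤ, ω i - ω j ≠ (n : ℂ)) :
    IsPadeSystem ω ρ (polySystem (padeCoeff ω ρ)) := by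
  have hrem := remainder_polySystem (ω := ω) (padeCoeff ω ρ)
  set G : ℂ → ℂ := fun z => ∑ i, padeCoeff ω ρ i * (1 - z) ^ node ω ρ i with hG
  have hGa : AnalyticAt ℂ G 0 := analyticAt_sum_one_sub_cpow _ _
  have hder : ∀ n < sigma ρ, iteratedDeriv n G 0 = if n = sigma ρ - 1 then 1 else 0 :=
    fun n hn => by
      rw [hG, iteratedDeriv_sum_one_sub_cpow, sum_padeCoeff_mul_falling hω hn]
  have hpos := sigma_pos ρ
  refine ⟨natDegree_polySystem_le _, hGa.congr hrem.symm, ?_, ?_⟩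
  · rw [analyticOrderAt_congr hrem, analyticOrderAt_eq_nat_iff_iteratedDeriv_eq_zero hGa]
    refine ⟨fun k hk => ?_, ?_⟩
    · rw [hder k (by omega), if_neg (by omega)]
    · rw [hder _ (by omega), if_pos rfl]
      exact one_ne_zero
  · obtain ⟨F, hF, hev⟩ := hGa.exists_eventuallyEq_sum_add_pow_mul (sigma ρ)
    have hlim : Tendsto (fun z : ℂ => 1 / ((sigma ρ - 1)! : ℂ) + z * F z) (𝓝[≠] 0)
        (𝓝 (1 / ((sigma ρ - 1)! : ℂ))) := by
      have : ContinuousAt (fun z : ℂ => 1 / ((sigma ρ - 1)! : ℂ) + z * F z) 0 :=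
        continuousAt_const.add (continuousAt_id.mul hF.continuousAt)
      simpa using this.tendsto.mono_left nhdsWithin_le_nhds
    refine hlim.congr' ?_
    filter_upwards [nhdsWithin_le_nhds hrem, nhdsWithin_le_nhds hev, self_mem_nhdsWithin]
      with z h1 h2 hz
    have hz : z ≠ 0 := hz
    have hs : z ^ sigma ρ = z ^ (sigma ρ - 1) * z := by
      rw [← pow_succ, Nat.sub_add_cancel hpos]
    rw [h1, h2, Finset.sum_eq_single (sigma ρ - 1), hder _ (by omega), if_pos rfl]
    · simp only [smul_eq_mul, hs]
      field_simp
    · intro n hn hne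
      rw [hder n (Finset.mem_range.mp hn), if_neg hne, smul_zero]
    · intro h
      exact absurd (Finset.mem_range.mpr (by omega)) h

/-- The difference of the remainders of two Padé systems vanishes to order `σ` because of the
normalization. -/
lemma IsPadeSystem.eq (hω : ∀ i j, i ≠ j → ∀ n : ℤ, ω i - ω j ≠ (n : ℂ))
    {H K : Fin (M + 1) → ℂ[X]} (hH : IsPadeSystem ω ρ H) (hK : IsPadeSystem ω ρ K) : H = K := by
  obtain ⟨c, rfl⟩ := exists_eq_polySystem hH.natDegree_le
  obtain ⟨d, rfl⟩ := exists_eq_polySystem hK.natDegree_le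
  obtain ⟨g, hg, hgev⟩ := (natCast_le_analyticOrderAt hH.analyticAt).mp hH.order_eq.ge
  obtain ⟨h, hh, hhev⟩ := (natCast_le_analyticOrderAt hK.analyticAt).mp hK.order_eq.ge
  have value : ∀ {f F : ℂ → ℂ}, AnalyticAt ℂ f 0 →
      (∀ᶠ z in 𝓝 0, F z = (z - 0) ^ (sigma ρ - 1) • f z) →
      Tendsto (fun z : ℂ => F z / z ^ (sigma ρ - 1)) (𝓝[≠] 0)
        (𝓝 (1 / ((sigma ρ - 1)! : ℂ))) → f 0 = 1 / ((sigma ρ - 1)! : ℂ) := by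
    intro f F hf hev hlim
    refine tendsto_nhds_unique (hf.continuousAt.tendsto.mono_left nhdsWithin_le_nhds)
      (hlim.congr' ?_)
    filter_upwards [nhdsWithin_le_nhds hev, self_mem_nhdsWithin] with z h1 hz
    have hz : z ≠ 0 := hz
    rw [h1, sub_zero, smul_eq_mul]
    field_simp
  have hgh : g 0 - h 0 = 0 := by
    rw [value hg hgev hH.tendsto, value hh hhev hK.tendsto, sub_self]
  have hord1 : ((1 : ℕ) : ℕ∞) ≤ analyticOrderAt (fun z => g z - h z) 0 := by
    rw [natCast_le_analyticOrderAt_iff_iteratedDeriv_eq_zero (hg.fun_sub hh)]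
    intro i hi
    obtain rfl : i = 0 := by omega
    simpa using hgh
  obtain ⟨q, hq, hqev⟩ := (natCast_le_analyticOrderAt (hg.fun_sub hh)).mp hord1
  have hord : (Fintype.card (Σ m, Fin (ρ m + 1)) : ℕ∞) ≤
      analyticOrderAt (fun z : ℂ => ∑ i, (c i - d i) * (1 - z) ^ node ω ρ i) 0 := by
    rw [natCast_le_analyticOrderAt (analyticAt_sum_one_sub_cpow _ _)]
    refine ⟨q, hq, ?_⟩
    filter_upwards [remainder_polySystem (ω := ω) c, remainder_polySystem (ω := ω) d, hgev, hhev,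
      hqev] with z h1 h2 h3 h4 h5
    have hs : z ^ sigma ρ = z ^ (sigma ρ - 1) * z := by
      rw [← pow_succ, Nat.sub_add_cancel (sigma_pos ρ)]
    simp only [sub_mul, Finset.sum_sub_distrib, card_exponents, sub_zero, smul_eq_mul,
      pow_one] at *
    rw [← h1, ← h2, h3, h4, ← mul_sub, h5, hs]
    ring
  have hcd : c = d := funext fun i =>
    sub_eq_zero.mp (coeff_eq_zero_of_card_le_order (c := fun i => c i - d i)
      (node_injective hω) hord i)
  rw [hcd]

/-! ### Identities for rising and falling factorials -/

lemma falling_eq_prod (x : ℂ) (n : ℕ) : falling x n = ∏ s : Fin n, (x - (s : ℕ)) := by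
  induction n with
  | zero => simp [falling]
  | succ n ih =>
    rw [Fin.prod_univ_castSucc, falling, descPochhammer_succ_eval, ← falling, ih]
    simp

lemma falling_neg (x : ℂ) (n : ℕ) : falling (-x) n = (-1) ^ n * rising x n := by
  have h := ascPochhammer_eval_neg_eq_descPochhammer ℂ (-x) n
  rw [neg_neg] at h
  rw [falling, rising, h, ← mul_assoc, ← mul_pow]
  simp

lemma rising_add (x : ℂ) (a b : ℕ) : rising x (a + b) = rising x a * rising (x + a) b := by
  rw [rising, rising, rising, ← ascPochhammer_mul]
  simp

lemma rising_reflect (x : ℂ) (n : ℕ) : rising (1 - x - n) n = (-1) ^ n * rising x n := by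
  rw [← falling_neg, falling, descPochhammer_eval_eq_ascPochhammer, rising]
  congr 1
  ring

lemma rising_ne_zero {x : ℂ} (hx : ∀ n : ℤ, x ≠ n) (n : ℕ) : rising x n ≠ 0 := by
  rw [rising, Ne, ascPochhammer_eval_eq_zero_iff]
  rintro ⟨k, -, hk⟩
  refine hx (-(k : ℤ)) ?_
  push_cast
  rw [hk, neg_neg]

lemma sub_natCast_ne_intCast {x : ℂ} (hx : ∀ n : ℤ, x ≠ n) (r : ℕ) (n : ℤ) : x - r ≠ n := by
  intro h
  refine hx (n + r) ?_
  push_cast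
  rw [← h, sub_add_cancel]

/-- Both products `rising (W - r) (ρ + 1) * rising (W - r + ρ + 1) r` and
`rising (W - r) r * rising W (ρ + 1)` equal `rising (W - r) (ρ + 1 + r)`. -/
lemma one_div_rising_sub {W : ℂ} (hW : ∀ n : ℤ, W ≠ n) (ρ r : ℕ) :
    1 / rising (W - r) (ρ + 1) =
      1 / rising W (ρ + 1) * (rising (-W - ρ) r / rising (1 - W) r) := by
  have h1 := rising_add (W - r) (ρ + 1) r
  have h2 := rising_add (W - r) r (ρ + 1)
  have h3 : rising (W - r) r = (-1) ^ r * rising (1 - W) r := by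
    rw [← rising_reflect]
    congr 1
    ring
  have h4 : rising (W - r + (ρ + 1 : ℕ)) r = (-1) ^ r * rising (-W - ρ) r := by
    rw [← rising_reflect]
    congr 1
    push_cast
    ring
  rw [add_comm (ρ + 1) r, h2, sub_add_cancel, h3, h4] at h1
  have hs : ((-1 : ℂ) ^ r) ≠ 0 := pow_ne_zero _ (by norm_num)
  have h5 : rising (1 - W) r * rising W (ρ + 1) = rising (W - r) (ρ + 1) * rising (-W - ρ) r := by
    apply mul_left_cancel₀ hs
    linear_combination h1
  have n1 := rising_ne_zero hW (ρ + 1)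
  have n2 := rising_ne_zero (sub_natCast_ne_intCast hW r) (ρ + 1)
  have n3 : rising (1 - W) r ≠ 0 := by
    refine rising_ne_zero (fun n hn => hW (1 - n) ?_) r
    push_cast
    rw [← hn]
    ring
  field_simp
  linear_combination h5

lemma prod_erase_sub_eq (r j : ℕ) :
    ∏ s ∈ (Finset.range (r + j + 1)).erase r, ((r : ℂ) - s) = (r ! : ℂ) * ((-1) ^ j * (j ! : ℂ)) := by
  induction j with
  | zero =>
    rw [add_zero, Finset.range_add_one, Finset.erase_insert (by simp),
      ← Finset.prod_range_reflect, ← Finset.prod_range_add_one_eq_factorial]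
    push_cast
    rw [pow_zero, Nat.factorial_zero, Nat.cast_one, one_mul, mul_one]
    refine Finset.prod_congr rfl fun s hs => ?_
    have := Finset.mem_range.mp hs
    rw [Nat.cast_sub (by omega), Nat.cast_sub (by omega)]
    push_cast
    ring
  | succ j ih =>
    rw [Finset.range_add_one, Finset.erase_insert_of_ne (by omega), Finset.prod_insert (by simp),
      ← add_assoc, ih, Nat.factorial_succ]
    push_cast
    ring

lemma prod_fin_erase_sub_eq {n : ℕ} (r : Fin (n + 1)) :
    ∏ s ∈ Finset.univ.erase r, (((r : ℕ) : ℂ) - (s : ℕ)) =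
      ((r : ℕ)! : ℂ) * ((-1) ^ (n - r : ℕ) * ((n - r : ℕ)! : ℂ)) := by
  rw [← prod_erase_sub_eq, Nat.add_sub_cancel' (by omega)]
  refine Finset.prod_bij (fun s _ => (s : ℕ)) ?_ ?_ ?_ ?_
  · intro s hs
    have := Finset.ne_of_mem_erase hs
    simp only [Finset.mem_erase, Finset.mem_range, ne_eq]
    exact ⟨fun h => this (Fin.ext h), s.2⟩
  · intro a _ b _ h
    exact Fin.ext h
  · intro b hb
    simp only [Finset.mem_erase, Finset.mem_range] at hb
    exact ⟨⟨b, hb.2⟩, by simpa [Fin.ext_iff] using hb.1, rfl⟩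
  · intro s _
    rfl

lemma prod_sigma_erase {ι : Type*} [Fintype ι] [DecidableEq ι] {κ : ι → Type*}
    [∀ i, Fintype (κ i)] [∀ i, DecidableEq (κ i)] (f : (Σ i, κ i) → ℂ) (m : ι) (r : κ m) :
    ∏ j ∈ Finset.univ.erase (⟨m, r⟩ : Σ i, κ i), f j =
      (∏ s ∈ Finset.univ.erase r, f ⟨m, s⟩) * ∏ k ∈ Finset.univ.erase m, ∏ s, f ⟨k, s⟩ := by
  classical
  have h1 : ∏ j ∈ Finset.univ.erase (⟨m, r⟩ : Σ i, κ i), f j =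
      ∏ j, if j = ⟨m, r⟩ then 1 else f j := by
    rw [← Finset.mul_prod_erase Finset.univ _ (Finset.mem_univ (⟨m, r⟩ : Σ i, κ i)), if_pos rfl,
      one_mul]
    exact Finset.prod_congr rfl fun j hj => (if_neg (Finset.ne_of_mem_erase hj)).symm
  rw [h1, Fintype.prod_sigma, ← Finset.mul_prod_erase Finset.univ _ (Finset.mem_univ m)]
  congr 1
  · rw [← Finset.mul_prod_erase Finset.univ _ (Finset.mem_univ r), if_pos rfl, one_mul]
    refine Finset.prod_congr rfl fun s hs => if_neg fun h => Finset.ne_of_mem_erase hs ?_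
    simpa using h
  · refine Finset.prod_congr rfl fun k hk => Finset.prod_congr rfl fun s _ => if_neg fun h => ?_
    exact Finset.ne_of_mem_erase hk (congrArg Sigma.fst h)

lemma prod_erase_eq_prod_succAbove {M : ℕ} (m : Fin (M + 1)) (f : Fin (M + 1) → ℂ) :
    ∏ k ∈ Finset.univ.erase m, f k = ∏ j, f (m.succAbove j) := by
  rw [Fin.univ_succAbove M m, Finset.erase_cons, Finset.prod_map]
  rfl

/-! ### Explicit coefficients, and the forms with Pochhammer symbols and Gamma functions -/

lemma padeCoeff_eq (ω : Fin (M + 1) → ℂ) (ρ : Fin (M + 1) → ℕ) (m : Fin (M + 1))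
    (r : Fin (ρ m + 1)) :
    padeCoeff ω ρ ⟨m, r⟩ = 1 / ((ρ m)! : ℂ) * ((-1) ^ (r : ℕ) * ((ρ m).choose r : ℂ) *
      ∏ k ∈ Finset.univ.erase m, 1 / rising (ω k - ω m - (r : ℕ)) (ρ k + 1)) := by
  have h1 : Lagrange.nodalWeight Finset.univ (node ω ρ) ⟨m, r⟩ =
      (((r : ℕ)! : ℂ) * ((-1) ^ (ρ m - r : ℕ) * ((ρ m - r : ℕ)! : ℂ)))⁻¹ *
        ∏ k ∈ Finset.univ.erase m,
          ((-1) ^ (ρ k + 1) * rising (ω k - ω m - (r : ℕ)) (ρ k + 1))⁻¹ := by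
    rw [Lagrange.nodalWeight, prod_sigma_erase, ← prod_fin_erase_sub_eq, ← Finset.prod_inv_distrib]
    congr 1
    · refine Finset.prod_congr rfl fun s _ => ?_
      simp [node]
    · refine Finset.prod_congr rfl fun k _ => ?_
      rw [← falling_neg, falling_eq_prod, ← Finset.prod_inv_distrib]
      refine Finset.prod_congr rfl fun s _ => ?_
      simp only [node]
      congr 1
      ring
  have h2 : sigma ρ - 1 = ρ m + ∑ k ∈ Finset.univ.erase m, (ρ k + 1) := by
    rw [sigma, ← Finset.add_sum_erase _ _ (Finset.mem_univ m)]
    omega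
  have hr : (r : ℕ) ≤ ρ m := by omega
  have h3 : (-1 : ℂ) ^ ρ m = (-1) ^ (r : ℕ) * (-1) ^ (ρ m - r : ℕ) := by
    rw [← pow_add, Nat.add_sub_cancel' hr]
  have h4 : ∀ a : ℕ, ((-1 : ℂ) ^ a) * ((-1 : ℂ) ^ a)⁻¹ = 1 := fun a =>
    mul_inv_cancel₀ (pow_ne_zero _ (by norm_num))
  have h5 : ((ρ m)! : ℂ) = (ρ m).choose r * (r : ℕ)! * (ρ m - r : ℕ)! := by
    exact_mod_cast (Nat.choose_mul_factorial_mul_factorial hr).symm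
  have n1 : ((r : ℕ)! : ℂ) ≠ 0 := by exact_mod_cast Nat.factorial_ne_zero _
  have n2 : ((ρ m - r : ℕ)! : ℂ) ≠ 0 := by exact_mod_cast Nat.factorial_ne_zero _
  have n3 : ((ρ m).choose r : ℂ) ≠ 0 := by exact_mod_cast (Nat.choose_pos hr).ne'
  have h6 : ((-1 : ℂ) ^ ∑ k ∈ Finset.univ.erase m, (ρ k + 1)) * ∏ k ∈ Finset.univ.erase m,
      ((-1) ^ (ρ k + 1) * rising (ω k - ω m - (r : ℕ)) (ρ k + 1))⁻¹ =
      ∏ k ∈ Finset.univ.erase m, 1 / rising (ω k - ω m - (r : ℕ)) (ρ k + 1) := by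
    rw [← Finset.prod_pow_eq_pow_sum, ← Finset.prod_mul_distrib]
    refine Finset.prod_congr rfl fun k _ => ?_
    rw [mul_inv, ← mul_assoc, h4, one_mul, one_div]
  have n4 : (-1 : ℂ) ^ (ρ m - r : ℕ) ≠ 0 := pow_ne_zero _ (by norm_num)
  rw [padeCoeff, h1, h2, pow_add, mul_mul_mul_comm, h6, h3, h5]
  field_simp

lemma eval_padePoly (ω : Fin (M + 1) → ℂ) (ρ : Fin (M + 1) → ℕ) (m : Fin (M + 1)) (z : ℂ) :
    (polySystem (padeCoeff ω ρ) m).eval z = 1 / ((ρ m)! : ℂ) *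
      ∑ r ∈ Finset.range (ρ m + 1), (z - 1) ^ r * ((ρ m).choose r : ℂ) *
        ∏ k ∈ Finset.univ.erase m, 1 / rising (ω k - ω m - r) (ρ k + 1) := by
  rw [eval_polySystem, Finset.sum_range, Finset.mul_sum]
  refine Finset.sum_congr rfl fun r _ => ?_
  rw [padeCoeff_eq, show z - 1 = (-1) * (1 - z) by ring, mul_pow]
  ring

lemma degree_padePoly (hω : ∀ i j, i ≠ j → ∀ n : ℤ, ω i - ω j ≠ (n : ℂ)) (m : Fin (M + 1)) :
    (polySystem (padeCoeff ω ρ) m).degree = (ρ m : WithBot ℕ) := by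
  have hd : (1 - X : ℂ[X]).degree = 1 := by
    rw [← neg_sub, degree_neg]
    exact degree_X_sub_C 1
  have hd' : ∀ n : ℕ, ((1 - X : ℂ[X]) ^ n).degree = n := fun n => by
    rw [degree_pow, hd]
    simp
  have hc : padeCoeff ω ρ ⟨m, Fin.last (ρ m)⟩ ≠ 0 := by
    rw [padeCoeff]
    exact mul_ne_zero (pow_ne_zero _ (by norm_num))
      (Lagrange.nodalWeight_ne_zero (node_injective hω).injOn (Finset.mem_univ _))
  have hlast : (C (padeCoeff ω ρ ⟨m, Fin.last (ρ m)⟩) * (1 - X) ^ ρ m : ℂ[X]).degree = ρ m := by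
    rw [degree_C_mul hc, hd']
  rw [polySystem, Fin.sum_univ_castSucc]
  simp only [Fin.val_last, Fin.val_castSucc]
  rw [degree_add_eq_right_of_degree_lt, hlast]
  rw [hlast]
  refine (degree_sum_le _ _).trans_lt ?_
  rw [Finset.sup_lt_iff (WithBot.bot_lt_coe _)]
  intro s _
  refine ((degree_mul_le _ _).trans (add_le_add degree_C_le le_rfl)).trans_lt ?_
  rw [hd', zero_add]
  exact_mod_cast s.2

lemma pFqTerm_eq_zero (ω : Fin (M + 1) → ℂ) (ρ : Fin (M + 1) → ℕ) (m : Fin (M + 1)) (x : ℂ)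
    {n : ℕ} (hn : ρ m < n) :
    pFqTerm (fun k => ω m - ω k - (ρ k : ℂ)) (fun j => 1 + ω m - ω (m.succAbove j)) x n = 0 := by
  rw [pFqTerm, Finset.prod_eq_zero (Finset.mem_univ m), zero_div, zero_mul]
  rw [sub_self, zero_sub, rising]
  exact ascPochhammer_eval_neg_coe_nat_of_lt hn

lemma eval_padePoly_eq_pFq (hω : ∀ i j, i ≠ j → ∀ n : ℤ, ω i - ω j ≠ (n : ℂ))
    (m : Fin (M + 1)) (z : ℂ) :
    (polySystem (padeCoeff ω ρ) m).eval z = 1 / ((ρ m)! : ℂ) *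
      (∏ k ∈ Finset.univ.erase m, 1 / rising (ω k - ω m) (ρ k + 1)) *
      pFq (fun k => ω m - ω k - (ρ k : ℂ)) (fun j => 1 + ω m - ω (m.succAbove j)) (1 - z) := by
  rw [pFq, tsum_eq_sum (s := Finset.range (ρ m + 1))
    fun n hn => pFqTerm_eq_zero ω ρ m _ (by simpa using hn), eval_padePoly, mul_assoc,
    Finset.mul_sum (Finset.range _) _ (∏ k ∈ Finset.univ.erase m, _)]
  congr 1
  refine Finset.sum_congr rfl fun r _ => ?_
  rw [pFqTerm, Fin.prod_univ_succAbove _ m, prod_erase_eq_prod_succAbove,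
    prod_erase_eq_prod_succAbove]
  have h1 : rising (ω m - ω m - ρ m) r = (-1) ^ r * ((ρ m).choose r * r !) := by
    rw [sub_self, zero_sub, rising, ascPochhammer_eval_neg_eq_descPochhammer,
      Nat.cast_choose_eq_descPochhammer_div, div_mul_cancel₀]
    exact_mod_cast Nat.factorial_ne_zero r
  have h2 : ∀ j, 1 / rising (ω (m.succAbove j) - ω m - r) (ρ (m.succAbove j) + 1) =
      1 / rising (ω (m.succAbove j) - ω m) (ρ (m.succAbove j) + 1) *
        (rising (ω m - ω (m.succAbove j) - ρ (m.succAbove j)) r /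
          rising (1 + ω m - ω (m.succAbove j)) r) := fun j => by
    rw [one_div_rising_sub (hω _ _ (Fin.succAbove_ne m j)), neg_sub, ← sub_add, sub_add_eq_add_sub]
  simp only [h2]
  rw [h1, Finset.prod_mul_distrib, Finset.prod_div_distrib (s := Finset.univ)
    (f := fun j => rising (ω m - ω (m.succAbove j) - ρ (m.succAbove j)) r),
    show z - 1 = (-1) * (1 - z) by ring,
    mul_pow]
  have n1 : (r ! : ℂ) ≠ 0 := by exact_mod_cast Nat.factorial_ne_zero r
  field_simp

lemma Gamma_add_natCast {x : ℂ} (hx : ∀ n : ℤ, x ≠ n) (n : ℕ) :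
    Gamma (x + n) = rising x n * Gamma x := by
  have hx' : ∀ k : ℕ, x ≠ -k := fun k h => hx (-k) (by simpa using h)
  rw [rising, ← Gamma_add_nat_div_Gamma_eq x hx', div_mul_cancel₀ _ (Gamma_ne_zero hx')]

/-- The case `r ≤ ρ_k` rests on the reflection formula for `Γ (W - r) Γ (1 - W + r)`. -/
lemma gammaCoeff_eq (hω : ∀ i j, i ≠ j → ∀ n : ℤ, ω i - ω j ≠ (n : ℂ)) {m k : Fin (M + 1)}
    (hk : k ≠ m) (r : ℕ) :
    gammaCoeff ω ρ m k r = (ρ k)! * (1 / rising (ω k - ω m - r) (ρ k + 1)) := by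
  have hW := hω k m hk
  rw [gammaCoeff]
  simp only [if_neg hk.symm]
  set W := ω k - ω m with hWdef
  have hWr := sub_natCast_ne_intCast hW r
  have n1 := rising_ne_zero hWr (ρ k + 1)
  have n2 : ((ρ k)! : ℂ) ≠ 0 := by exact_mod_cast Nat.factorial_ne_zero _
  have n3 : (r ! : ℂ) ≠ 0 := by exact_mod_cast Nat.factorial_ne_zero _
  have hne : ∀ a : ℤ, ∀ n : ℤ, (a : ℂ) - W ≠ n := fun a n h => hW (a - n) (by
    push_cast
    rw [← h]
    ring)
  have hΓ : ∀ x : ℂ, (∀ n : ℤ, x ≠ n) → Gamma x ≠ 0 := fun x hx =>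
    Gamma_ne_zero fun n h => hx (-n) (by simpa using h)
  split_ifs with hr
  · have hrk : ((r - ρ k : ℕ) : ℂ) = r - ρ k := Nat.cast_sub hr.le
    have hx : ∀ n : ℤ, (r : ℂ) - ρ k - W ≠ n := by
      have := hne (r - ρ k : ℤ)
      push_cast at this
      exact this
    have h1 := Gamma_add_natCast hx (ρ k + 1)
    have h2 : rising ((r : ℂ) - ρ k - W) (ρ k + 1) = (-1) ^ (ρ k + 1) * rising (W - r) (ρ k + 1) := by
      rw [← rising_reflect]
      congr 1
      push_cast
      ring
    rw [show (r : ℂ) - ρ k - W + (ρ k + 1 : ℕ) = r + 1 - W by push_cast; ring, h2] at h1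
    have n4 := hΓ _ hx
    have n5 : ((r - ρ k : ℕ)! : ℂ) ≠ 0 := by exact_mod_cast Nat.factorial_ne_zero _
    have n6 : (r.choose (ρ k) : ℂ) ≠ 0 := by exact_mod_cast (Nat.choose_pos hr.le).ne'
    have h5 : (r ! : ℂ) = r.choose (ρ k) * (ρ k)! * (r - ρ k : ℕ)! := by
      exact_mod_cast (Nat.choose_mul_factorial_mul_factorial hr.le).symm
    rw [hrk.symm] at n4 h1 ⊢
    rw [h1, Gamma_nat_eq_factorial, Gamma_nat_eq_factorial, h5]
    have n7 : (-1 : ℂ) ^ (ρ k + 1) ≠ 0 := pow_ne_zero _ (by norm_num)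
    field_simp
  · push Not at hr
    have hrk : ((ρ k - r : ℕ) : ℂ) = ρ k - r := Nat.cast_sub hr
    have h1 := Gamma_add_natCast hWr (ρ k + 1)
    rw [show W - r + (ρ k + 1 : ℕ) = ρ k - r + 1 + W by push_cast; ring] at h1
    have h2 := Gamma_mul_Gamma_one_sub (W - r)
    rw [show 1 - (W - r) = r + 1 - W by ring, mul_sub, mul_comm (π : ℂ) r,
      Complex.sin_antiperiodic.sub_nat_mul_eq] at h2
    have n4 := hΓ _ hWr
    have n5 := hΓ (r + 1 - W) (by
      have := hne (r + 1 : ℤ)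
      push_cast at this
      exact this)
    have n6 : ((ρ k - r : ℕ)! : ℂ) ≠ 0 := by exact_mod_cast Nat.factorial_ne_zero _
    have h5 : ((ρ k)! : ℂ) = (ρ k).choose r * r ! * (ρ k - r : ℕ)! := by
      exact_mod_cast (Nat.choose_mul_factorial_mul_factorial hr).symm
    have h6 : π / sin (π * W) = (-1) ^ r * (Gamma (W - r) * Gamma (r + 1 - W)) := by
      rw [h2, div_eq_mul_inv, div_eq_mul_inv, mul_inv]
      have : (-1 : ℂ) ^ r * ((-1) ^ r)⁻¹ = 1 := mul_inv_cancel₀ (pow_ne_zero _ (by norm_num))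
      linear_combination (-(π : ℂ) * (sin (π * W))⁻¹) * this
    have h7 : (-1 : ℂ) ^ r * (-1) ^ r = 1 := by
      rw [← mul_pow]
      simp
    rw [h6, h1, Gamma_nat_eq_factorial, ← hrk, Gamma_nat_eq_factorial, h5]
    field_simp
    linear_combination ((ρ k).choose r : ℂ) * h7

lemma eval_padePoly_eq_gammaCoeff (hω : ∀ i j, i ≠ j → ∀ n : ℤ, ω i - ω j ≠ (n : ℂ))
    (m : Fin (M + 1)) (z : ℂ) :
    (polySystem (padeCoeff ω ρ) m).eval z = 1 / (vecFactorial ρ : ℂ) *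
      ∑ r ∈ Finset.range (ρ m + 1), (z - 1) ^ r * ∏ k, gammaCoeff ω ρ m k r := by
  rw [eval_padePoly, Finset.mul_sum, Finset.mul_sum]
  refine Finset.sum_congr rfl fun r _ => ?_
  have h1 : ∏ k, gammaCoeff ω ρ m k r = (ρ m).choose r * ((∏ k ∈ Finset.univ.erase m, ((ρ k)! : ℂ)) *
      ∏ k ∈ Finset.univ.erase m, 1 / rising (ω k - ω m - r) (ρ k + 1)) := by
    rw [← Finset.mul_prod_erase _ _ (Finset.mem_univ m), ← Finset.prod_mul_distrib]
    congr 1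
    · simp [gammaCoeff]
    · exact Finset.prod_congr rfl fun k hk => gammaCoeff_eq hω (Finset.ne_of_mem_erase hk) r
  have h2 : (vecFactorial ρ : ℂ) = (ρ m)! * ∏ k ∈ Finset.univ.erase m, ((ρ k)! : ℂ) := by
    rw [vecFactorial, ← Finset.mul_prod_erase _ _ (Finset.mem_univ m)]
    push_cast
    rfl
  have n1 : ∏ k ∈ Finset.univ.erase m, ((ρ k)! : ℂ) ≠ 0 :=
    Finset.prod_ne_zero_iff.mpr fun k _ => by exact_mod_cast Nat.factorial_ne_zero _
  rw [h1, h2]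
  field_simp

/-! ### Contour integrals over piecewise `C¹` paths -/

section Contour

variable {a b : ℂ} {γ : Path a b} {f g F : ℂ → ℂ}

lemma contourIntegral_eq (f : ℂ → ℂ) (γ : Path a b) :
    contourIntegral f γ = ∫ t in (0 : ℝ)..1, f (γ.extend t) * deriv γ.extend t := by
  rw [contourIntegral, curveIntegral_eq_intervalIntegral_deriv]
  refine intervalIntegral.integral_congr fun t _ => ?_
  simp [mul_comm]

lemma extend_mem_range (γ : Path a b) (t : ℝ) : γ.extend t ∈ Set.range γ := by
  rw [← Path.extend_range]
  exact Set.mem_range_self t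

lemma contourIntegral_congr (h : Set.EqOn f g (Set.range γ)) :
    contourIntegral f γ = contourIntegral g γ := by
  rw [contourIntegral_eq, contourIntegral_eq]
  refine intervalIntegral.integral_congr fun t _ => ?_
  simp only [h (extend_mem_range γ t)]

lemma intervalIntegrable_piece {s t : ℝ} (hst : s < t)
    (hγ : ContDiffOn ℝ 1 γ.extend (Set.Icc s t)) (hf : ContinuousOn f (Set.range γ)) :
    IntervalIntegrable (fun u => f (γ.extend u) * deriv γ.extend u) MeasureTheory.volume s t := by
  have hc : ContinuousOn (fun u => f (γ.extend u) * derivWithin γ.extend (Set.Icc s t) u)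
      (Set.Icc s t) :=
    ((hf.comp_continuous γ.extend.continuous (extend_mem_range γ)).continuousOn).mul
      (hγ.continuousOn_derivWithin (uniqueDiffOn_Icc hst) le_rfl)
  refine (hc.intervalIntegrable_of_Icc hst.le).congr_uIoo fun u hu => ?_
  rw [Set.uIoo_of_le hst.le] at hu
  simp only
  rw [derivWithin_of_mem_nhds (Icc_mem_nhds hu.1 hu.2)]

lemma IsPiecewiseC1.intervalIntegrable (hγ : IsPiecewiseC1 γ)
    (hf : ContinuousOn f (Set.range γ)) :
    IntervalIntegrable (fun u => f (γ.extend u) * deriv γ.extend u) MeasureTheory.volume 0 1 := by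
  obtain ⟨n, τ, h0, h1, hτ⟩ := hγ
  rw [← h0, ← h1]
  exact IntervalIntegrable.trans_iterate fun k hk =>
    intervalIntegrable_piece (hτ k hk).1 (hτ k hk).2 hf

/-- The fundamental theorem of calculus along a piecewise `C¹` path. -/
lemma IsPiecewiseC1.contourIntegral_eq_sub (hγ : IsPiecewiseC1 γ)
    (hF : ∀ ξ ∈ Set.range γ, HasDerivAt F (f ξ) ξ) (hf : ContinuousOn f (Set.range γ)) :
    contourIntegral f γ = F b - F a := by
  obtain ⟨n, τ, h0, h1, hτ⟩ := hγ
  rw [contourIntegral_eq, ← h0, ← h1, ← intervalIntegral.sum_integral_adjacent_intervals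
    fun k hk => intervalIntegrable_piece (hτ k hk).1 (hτ k hk).2 hf]
  have hpiece : ∀ k ∈ Finset.range n,
      ∫ u in τ k..τ (k + 1), f (γ.extend u) * deriv γ.extend u =
        F (γ.extend (τ (k + 1))) - F (γ.extend (τ k)) := by
    intro k hk
    obtain ⟨hlt, hC⟩ := hτ k (Finset.mem_range.mp hk)
    refine intervalIntegral.integral_eq_sub_of_hasDerivAt_of_le
      (f := fun u => F (γ.extend u)) hlt.le ?_ ?_ (intervalIntegrable_piece hlt hC hf)
    · intro u _
      exact ((hF _ (extend_mem_range γ u)).continuousAt.comp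
        γ.extend.continuous.continuousAt).continuousWithinAt
    · intro u hu
      have hd : HasDerivAt γ.extend (deriv γ.extend u) u :=
        (((hC.differentiableOn one_ne_zero) u ⟨hu.1.le, hu.2.le⟩).differentiableAt
          (Icc_mem_nhds hu.1 hu.2)).hasDerivAt
      exact (hF _ (extend_mem_range γ u)).comp u hd
  rw [Finset.sum_congr rfl hpiece, Finset.sum_range_sub (fun k => F (γ.extend (τ k))), h0, h1,
    γ.extend_zero, γ.extend_one]

lemma IsPiecewiseC1.contourIntegral_sum {ι : Type*} (s : Finset ι) {f : ι → ℂ → ℂ}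
    (hγ : IsPiecewiseC1 γ) (hf : ∀ i ∈ s, ContinuousOn (f i) (Set.range γ)) :
    contourIntegral (fun ξ => ∑ i ∈ s, f i ξ) γ = ∑ i ∈ s, contourIntegral (f i) γ := by
  simp only [contourIntegral_eq, Finset.sum_mul]
  exact intervalIntegral.integral_finsetSum fun i hi => hγ.intervalIntegrable (hf i hi)

lemma IsPiecewiseC1.contourIntegral_add (hγ : IsPiecewiseC1 γ)
    (hf : ContinuousOn f (Set.range γ)) (hg : ContinuousOn g (Set.range γ)) :
    contourIntegral (fun ξ => f ξ + g ξ) γ = contourIntegral f γ + contourIntegral g γ := by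
  simp only [contourIntegral_eq, add_mul]
  exact intervalIntegral.integral_add (hγ.intervalIntegrable hf) (hγ.intervalIntegrable hg)

lemma contourIntegral_const_mul (c : ℂ) (f : ℂ → ℂ) (γ : Path a b) :
    contourIntegral (fun ξ => c * f ξ) γ = c * contourIntegral f γ := by
  simp only [contourIntegral_eq, mul_assoc]
  exact intervalIntegral.integral_const_mul _ _

end Contour

/-! ### Winding numbers and the residue formula -/

section Winding

variable {a : ℂ} {γ : Path a a} {p q : ℂ}

lemma isCompact_range_path (γ : Path a a) : IsCompact (Set.range γ) :=
  isCompact_range γ.continuous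

lemma continuousOn_one_div_sub (hp : p ∉ Set.range γ) :
    ContinuousOn (fun ξ => 1 / (ξ - p)) (Set.range γ) := by
  refine continuousOn_const.div (by fun_prop) fun ξ hξ h => hp ?_
  rwa [← sub_eq_zero.mp h]

/-- The winding integral is locally constant off the path: for `q` close to `p`, the function
`log ((ξ - q) / (ξ - p))` is a primitive of the difference of the integrands. -/
lemma IsPiecewiseC1.winding_eventually_eq (hγ : IsPiecewiseC1 γ) (hp : p ∉ Set.range γ) :
    ∀ᶠ q in 𝓝 p,
      contourIntegral (fun ξ => 1 / (ξ - p)) γ = contourIntegral (fun ξ => 1 / (ξ - q)) γ := by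
  have hcl := (isCompact_range_path γ).isClosed
  obtain ⟨ε, hε, hball⟩ := Metric.isOpen_iff.mp hcl.isOpen_compl p hp
  filter_upwards [hcl.isOpen_compl.mem_nhds hp, Metric.ball_mem_nhds p hε] with q hq hqε
  have hdist : ∀ ξ ∈ Set.range γ, ‖p - q‖ < ‖ξ - p‖ := by
    intro ξ hξ
    by_contra! hlt
    refine hball (a := ξ) ?_ hξ
    rw [Metric.mem_ball, dist_eq_norm] at hqε ⊢
    rw [norm_sub_rev] at hqε
    exact hlt.trans_lt hqε
  have key : contourIntegral (fun ξ => 1 / (ξ - q) + (-1) * (1 / (ξ - p))) γ =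
      log ((a - q) / (a - p)) - log ((a - q) / (a - p)) := by
    refine hγ.contourIntegral_eq_sub (F := fun ξ => log ((ξ - q) / (ξ - p))) ?_
      ((continuousOn_one_div_sub hq).add (continuousOn_const.fun_mul (continuousOn_one_div_sub hp)))
    intro ξ hξ
    have h1 : ξ - p ≠ 0 := fun h => hp (by rwa [← sub_eq_zero.mp h])
    have h2 : ξ - q ≠ 0 := fun h => hq (by rwa [← sub_eq_zero.mp h])
    have hslit : (ξ - q) / (ξ - p) ∈ slitPlane := by
      have : (ξ - q) / (ξ - p) = 1 + (p - q) / (ξ - p) := by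
        field_simp
        ring
      rw [this]
      refine mem_slitPlane_of_norm_lt_one ?_
      rw [norm_div, div_lt_one (norm_pos_iff.mpr h1)]
      exact hdist ξ hξ
    have hd := (((hasDerivAt_id' ξ).sub_const q).fun_div ((hasDerivAt_id' ξ).sub_const p) h1).clog hslit
    convert hd using 1
    field_simp
    ring
  rw [sub_self, hγ.contourIntegral_add (continuousOn_one_div_sub hq)
    (continuousOn_const.fun_mul (continuousOn_one_div_sub hp)), contourIntegral_const_mul] at key
  linear_combination -key

/-- For `q` far away, `log (1 - ξ / q)` is a primitive of the integrand. -/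
lemma IsPiecewiseC1.winding_eq_zero_of_norm_lt (hγ : IsPiecewiseC1 γ)
    (hq : ∀ ξ ∈ Set.range γ, ‖ξ‖ < ‖q‖) : contourIntegral (fun ξ => 1 / (ξ - q)) γ = 0 := by
  have hq' : q ∉ Set.range γ := fun h => lt_irrefl _ (hq q h)
  have hq0 : q ≠ 0 := norm_pos_iff.mp ((norm_nonneg a).trans_lt (hq a ⟨0, γ.source⟩))
  rw [hγ.contourIntegral_eq_sub (F := fun ξ => log (1 - ξ / q)) ?_ (continuousOn_one_div_sub hq'),
    sub_self]
  intro ξ hξ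
  have h2 : ξ - q ≠ 0 := fun h => hq' (by rwa [← sub_eq_zero.mp h])
  have h3 : q - ξ ≠ 0 := by rwa [← neg_sub, neg_ne_zero]
  have hslit : 1 - ξ / q ∈ slitPlane := by
    rw [sub_eq_add_neg]
    refine mem_slitPlane_of_norm_lt_one ?_
    rw [norm_neg, norm_div, div_lt_one (norm_pos_iff.mpr hq0)]
    exact hq ξ hξ
  have hd := (((hasDerivAt_id' ξ).div_const q).const_sub 1).clog hslit
  convert hd using 1
  rw [show (1 : ℂ) - ξ / q = (q - ξ) / q by field_simp, ← neg_sub q ξ]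
  field_simp

lemma IsPiecewiseC1.winding_eq_zero_of_mem_outside (hγ : IsPiecewiseC1 γ) (hp : p ∈ outside γ) :
    contourIntegral (fun ξ => 1 / (ξ - p)) γ = 0 := by
  obtain ⟨hpr, hunb⟩ := hp
  obtain ⟨R, hR⟩ := (isCompact_range_path γ).isBounded.exists_norm_le
  have hq : ∃ q ∈ connectedComponentIn (Set.range γ)ᶜ p, R < ‖q‖ := by
    by_contra! h
    exact hunb (isBounded_iff_forall_norm_le.mpr ⟨R, h⟩)
  obtain ⟨q, hqC, hqR⟩ := hq
  have hconst : contourIntegral (fun ξ => 1 / (ξ - p)) γ =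
      contourIntegral (fun ξ => 1 / (ξ - q)) γ := by
    refine isPreconnected_connectedComponentIn.induction₂
      (fun x y => contourIntegral (fun ξ => 1 / (ξ - x)) γ =
        contourIntegral (fun ξ => 1 / (ξ - y)) γ) ?_ (fun _ _ _ _ _ _ h₁ h₂ => h₁.trans h₂)
      (fun _ _ _ _ h => h.symm) (mem_connectedComponentIn hpr) hqC
    intro x hx
    have hx' : x ∉ Set.range γ := connectedComponentIn_subset _ _ hx
    exact nhdsWithin_le_nhds (hγ.winding_eventually_eq hx')
  rw [hconst, hγ.winding_eq_zero_of_norm_lt fun ξ hξ => (hR ξ hξ).trans_lt hqR]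

/-- Cauchy's formula for an entire function and an arbitrary closed path; the difference quotient
`dslope e p` is entire and hence has a primitive. -/
lemma IsPiecewiseC1.contourIntegral_mul_one_div_sub (hγ : IsPiecewiseC1 γ) {e : ℂ → ℂ}
    (he : Differentiable ℂ e) (hp : p ∉ Set.range γ) :
    contourIntegral (fun ξ => e ξ * (1 / (ξ - p))) γ =
      e p * contourIntegral (fun ξ => 1 / (ξ - p)) γ := by
  have hds : Differentiable ℂ (dslope e p) := by
    rw [← differentiableOn_univ, differentiableOn_dslope univ_mem]
    exact he.differentiableOn
  obtain ⟨F, hF⟩ := hds.isExactOn_univ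
  have hzero : contourIntegral (dslope e p) γ = 0 := by
    rw [hγ.contourIntegral_eq_sub (fun ξ _ => hF ξ (Set.mem_univ ξ)) hds.continuous.continuousOn,
      sub_self]
  have hcongr : Set.EqOn (fun ξ => e ξ * (1 / (ξ - p)))
      (fun ξ => e p * (1 / (ξ - p)) + dslope e p ξ) (Set.range γ) := by
    intro ξ hξ
    have hne : ξ ≠ p := fun h => hp (h ▸ hξ)
    have h1 : ξ - p ≠ 0 := sub_ne_zero.mpr hne
    simp only
    rw [dslope_of_ne _ hne, slope_def_field]
    field_simp
    ring
  rw [contourIntegral_congr hcongr, hγ.contourIntegral_add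
    (continuousOn_const.fun_mul (continuousOn_one_div_sub hp)) hds.continuous.continuousOn,
    contourIntegral_const_mul, hzero, add_zero]

end Winding

/-! ### The contour integral for the Padé approximants -/

/-- Partial fractions: the first barycentric form of Lagrange interpolation of the constant `1`. -/
lemma prod_one_div_falling (hω : ∀ i j, i ≠ j → ∀ n : ℤ, ω i - ω j ≠ (n : ℂ)) {ξ : ℂ}
    (hξ : ∀ i, ξ ≠ node ω ρ i) :
    ∏ k, 1 / falling (ξ - ω k) (ρ k + 1) =
      ∑ i, Lagrange.nodalWeight Finset.univ (node ω ρ) i * (1 / (ξ - node ω ρ i)) := by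
  have h1 := Lagrange.eval_interpolate_not_at_node (s := Finset.univ) (v := node ω ρ) 1
    (x := ξ) fun i _ => hξ i
  rw [Lagrange.interpolate_one (node_injective hω).injOn ⟨⟨0, 0⟩, Finset.mem_univ _⟩, eval_one,
    Lagrange.eval_nodal, Fintype.prod_sigma] at h1
  have h2 : ∀ k, ∏ s : Fin (ρ k + 1), (ξ - node ω ρ ⟨k, s⟩) = falling (ξ - ω k) (ρ k + 1) := by
    intro k
    rw [falling_eq_prod]
    exact Finset.prod_congr rfl fun s _ => by rw [node]; ring
  simp only [h2, Pi.one_apply, mul_one, ← one_div] at h1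
  rw [Finset.prod_div_distrib, Finset.prod_const_one]
  exact (eq_one_div_of_mul_eq_one_right h1.symm).symm

lemma eval_padePoly_eq_contourIntegral (hω : ∀ i j, i ≠ j → ∀ n : ℤ, ω i - ω j ≠ (n : ℂ))
    (m : Fin (M + 1)) {a : ℂ} {γ : Path a a} (hγ : IsSimplePositiveContour γ)
    (hin : ∀ r ≤ ρ m, ω m + (r : ℂ) ∈ inside γ)
    (hout : ∀ k, k ≠ m → ∀ r ≤ ρ k, ω k + (r : ℂ) ∈ outside γ) {z : ℂ} (hz : z ≠ 1) :
    (polySystem (padeCoeff ω ρ) m).eval z = (-1) ^ (sigma ρ - 1) / (2 * π * I) *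
      contourIntegral (fun ξ => (1 - z) ^ (ξ - ω m) *
        ∏ k, 1 / falling (ξ - ω k) (ρ k + 1)) γ := by
  have hpc := hγ.piecewiseC1
  have hz' : 1 - z ≠ 0 := sub_ne_zero.mpr hz.symm
  have hnode : ∀ i, node ω ρ i ∉ Set.range γ := by
    rintro ⟨k, s⟩
    by_cases hk : k = m
    · subst hk
      exact (hin s (by omega)).1
    · exact (hout k hk s (by omega)).1
  have he : Differentiable ℂ fun ξ : ℂ => (1 - z) ^ (ξ - ω m) := by
    intro ξ
    exact (((hasDerivAt_id ξ).sub_const (ω m)).const_cpow (Or.inl hz')).differentiableAt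
  have hcongr : Set.EqOn
      (fun ξ => (1 - z) ^ (ξ - ω m) * ∏ k, 1 / falling (ξ - ω k) (ρ k + 1))
      (fun ξ => ∑ i, Lagrange.nodalWeight Finset.univ (node ω ρ) i *
        ((1 - z) ^ (ξ - ω m) * (1 / (ξ - node ω ρ i)))) (Set.range γ) := by
    intro ξ hξ
    simp only
    rw [prod_one_div_falling hω fun i h => hnode i (h ▸ hξ), Finset.mul_sum]
    exact Finset.sum_congr rfl fun i _ => by ring
  rw [contourIntegral_congr hcongr, hpc.contourIntegral_sum _ fun i _ => continuousOn_const.fun_mul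
    (he.continuous.continuousOn.fun_mul (continuousOn_one_div_sub (hnode i)))]
  simp only [contourIntegral_const_mul, hpc.contourIntegral_mul_one_div_sub he (hnode _)]
  rw [Fintype.sum_sigma, Finset.sum_eq_single m, eval_polySystem, Finset.mul_sum]
  · refine Finset.sum_congr rfl fun r _ => ?_
    rw [node, hγ.positive _ (hin r (by omega)), add_sub_cancel_left, cpow_natCast, padeCoeff]
    have := two_pi_I_ne_zero
    field_simp
  · intro k _ hk
    refine Finset.sum_eq_zero fun s _ => ?_
    rw [node, hpc.winding_eq_zero_of_mem_outside (hout k hk s (by omega)), mul_zero, mul_zero]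
  · simp

/-! ### Iterated integrals over unit circles -/

/-- Integrability over `[-π, π]` of the integrand, in the angle, of `unitCircleIntegral f`. -/
def CircleIntegrableAngle (f : ℂ → ℂ) : Prop :=
  IntervalIntegrable (fun θ : ℝ => f (exp (θ * I)) * (I * exp (θ * I))) MeasureTheory.volume (-π) π

/-- Fubini's theorem is not needed for sums of products: each inner integral is again such a sum
in the outer variables. -/
lemma iteratedCircleIntegral_sum_prod {ι : Type*} (s : Finset ι) {n : ℕ} (c : ι → ℂ)
    (g : ι → Fin n → ℂ → ℂ) (hg : ∀ i ∈ s, ∀ j, CircleIntegrableAngle (g i j)) :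
    iteratedCircleIntegral n (fun t => ∑ i ∈ s, c i * ∏ j, g i j (t j)) =
      ∑ i ∈ s, c i * ∏ j, unitCircleIntegral (g i j) := by
  induction n generalizing c with
  | zero => simp [iteratedCircleIntegral]
  | succ n ih =>
    have hinner : ∀ t : ℂ, iteratedCircleIntegral n
        (fun v => ∑ i ∈ s, c i * ∏ j, g i j (Fin.cons (α := fun _ => ℂ) t v j)) =
        ∑ i ∈ s, (c i * ∏ j : Fin n, unitCircleIntegral (g i j.succ)) * g i 0 t := by
      intro t
      have h := ih (fun i => c i * g i 0 t) (fun i j => g i j.succ) fun i hi j => hg i hi _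
      simp only [Fin.prod_univ_succ, Fin.cons_zero, Fin.cons_succ, ← mul_assoc]
      rw [h]
      exact Finset.sum_congr rfl fun i _ => by ring
    rw [iteratedCircleIntegral]
    simp only [hinner]
    rw [unitCircleIntegral]
    simp only [Finset.sum_mul]
    rw [intervalIntegral.integral_finsetSum]
    · refine Finset.sum_congr rfl fun i _ => ?_
      simp only [mul_assoc]
      rw [intervalIntegral.integral_const_mul, intervalIntegral.integral_const_mul,
        Fin.prod_univ_succ, mul_comm (unitCircleIntegral (g i 0)), unitCircleIntegral]
    · intro i hi
      have := (hg i hi 0).const_mul (c i * ∏ j : Fin n, unitCircleIntegral (g i j.succ))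
      simpa only [mul_assoc] using this

lemma exp_mul_I_cpow {θ : ℝ} (h1 : -π < θ) (h2 : θ ≤ π) (s : ℂ) :
    exp (θ * I) ^ s = exp (θ * I * s) := by
  rw [cpow_def_of_ne_zero (exp_ne_zero _), log_exp (by simpa using h1) (by simpa using h2)]

lemma integral_exp_mul_angle {c : ℂ} (hc : c ≠ 0) :
    ∫ θ in (-π)..π, I * exp (θ * I * c) = 2 * I * sin (π * c) / c := by
  have hIc : I * c ≠ 0 := mul_ne_zero I_ne_zero hc
  have h : ∀ θ : ℝ, I * exp (θ * I * c) = I * exp (I * c * θ) := fun θ => by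
    congr 2
    ring
  simp only [h]
  rw [intervalIntegral.integral_const_mul, integral_exp_mul_complex hIc, sin]
  have e1 : I * c * (π : ℝ) = π * c * I := by ring
  have e2 : I * c * ((-π : ℝ) : ℂ) = -(π * c) * I := by
    push_cast
    ring
  rw [e1, e2]
  field_simp
  rw [I_sq]
  ring

/-- Both sides are, up to the sign `(-1) ^ ρ`, the `ρ`-th forward difference of `1 / x`. -/
lemma sum_choose_mul_one_div {x : ℂ} (hx : ∀ n : ℤ, x ≠ n) (ρ : ℕ) :
    ∑ j ∈ Finset.range (ρ + 1), ((-1) ^ j * (ρ.choose j : ℂ)) * (1 / (x + j)) =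
      (ρ ! : ℂ) * (1 / rising x (ρ + 1)) := by
  have hshift : ∀ {x : ℂ}, (∀ n : ℤ, x ≠ n) → ∀ n : ℤ, x + 1 ≠ n := fun {x} hx n h =>
    hx (n - 1) (by push_cast; rw [← h]; ring)
  have hdiff : ∀ n : ℕ, ∀ x : ℂ, (∀ k : ℤ, x ≠ k) →
      (fwdDiff 1)^[n] (fun x : ℂ => 1 / x) x = (-1) ^ n * ((n ! : ℂ) * (1 / rising x (n + 1))) := by
    intro n
    induction n with
    | zero => intro x _; simp [rising]
    | succ n ih =>
      intro x hx
      have h1 := rising_add x 1 (n + 1)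
      have h2 : rising x (n + 1 + 1) = rising x (n + 1) * (x + (n + 1 : ℕ)) := by
        rw [rising, ascPochhammer_succ_eval, rising]
      have h3 : rising x 1 = x := by simp [rising]
      rw [h3, add_comm 1 (n + 1), Nat.cast_one, h2] at h1
      have n1 := rising_ne_zero hx (n + 1)
      have n2 := rising_ne_zero (hshift hx) (n + 1)
      have n3 : x ≠ 0 := by simpa using hx 0
      have n4 : x + (n + 1 : ℕ) ≠ 0 := fun h => hx (-(n + 1 : ℕ)) (by
        push_cast at h ⊢
        linear_combination h)
      rw [Function.iterate_succ_apply', fwdDiff, ih x hx, ih (x + 1) (hshift hx), h2,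
        Nat.factorial_succ]
      have h4 : rising (x + 1) (n + 1) = rising x (n + 1) * (x + (n + 1 : ℕ)) / x := by
        rw [h1]
        field_simp
      rw [h4]
      push_cast at n4 ⊢
      field_simp
      ring
  have h := fwdDiff_iter_eq_sum_shift (1 : ℂ) (fun x : ℂ => 1 / x) ρ x
  rw [hdiff ρ x hx] at h
  have hs : ((-1 : ℂ) ^ ρ) ≠ 0 := pow_ne_zero _ (by norm_num)
  apply mul_left_cancel₀ hs
  rw [h, Finset.mul_sum]
  refine Finset.sum_congr rfl fun j hj => ?_
  have hj' : j ≤ ρ := by have := Finset.mem_range.mp hj; omega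
  have : (-1 : ℂ) ^ ρ * (-1) ^ j = (-1) ^ (ρ - j) := by
    conv_lhs => rw [← Nat.sub_add_cancel hj', pow_add, mul_assoc, ← mul_pow]
    simp
  rw [← mul_assoc, ← mul_assoc, this]
  simp

/-- The factor `t ^ (-w - 1) * t ^ v * (1 + t) ^ ρ * t ^ (-r)` contributed by one variable to the
`r`-th term of the integrand, once its last binomial power is expanded; here `w = ω_m`, `v = ω_k`
and `ρ = ρ_k`. -/
noncomputable def circleFactor (w v : ℂ) (ρ r : ℕ) (t : ℂ) : ℂ :=
  t ^ (-w - 1) * (t ^ v * (1 + t) ^ ρ) * (t ^ r)⁻¹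

/-- The angle `-π` is excluded, since the principal argument of `exp (-π * I)` is `π`; this does not
affect the integrals. -/
lemma circleFactor_mul_eq (w v : ℂ) (ρ r : ℕ) {θ : ℝ} (h1 : -π < θ) (h2 : θ ≤ π) :
    circleFactor w v ρ r (exp (θ * I)) * (I * exp (θ * I)) =
      ∑ j ∈ Finset.range (ρ + 1), (ρ.choose j : ℂ) * (I * exp (θ * I * (v - w - r + j))) := by
  have hexp : ∀ j : ℕ, exp (θ * I * (v - w - r + j)) =
      exp (θ * I * (-w - 1)) * exp (θ * I * v) * exp (θ * I) ^ j * (exp (θ * I) ^ r)⁻¹ *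
        exp (θ * I) := by
    intro j
    rw [← exp_nat_mul, ← exp_nat_mul, ← exp_neg, ← exp_add, ← exp_add, ← exp_add, ← exp_add]
    congr 1
    ring
  rw [circleFactor, exp_mul_I_cpow h1 h2, exp_mul_I_cpow h1 h2, add_comm 1 (exp (θ * I)), add_pow,
    Finset.mul_sum, Finset.mul_sum, Finset.sum_mul, Finset.sum_mul]
  refine Finset.sum_congr rfl fun j _ => ?_
  rw [hexp, one_pow]
  ring

lemma circleIntegrableAngle_circleFactor (w v : ℂ) (ρ r : ℕ) :
    CircleIntegrableAngle (circleFactor w v ρ r) := by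
  have hc : Continuous fun θ : ℝ => ∑ j ∈ Finset.range (ρ + 1),
      (ρ.choose j : ℂ) * (I * exp (θ * I * (v - w - r + j))) := by fun_prop
  refine (hc.intervalIntegrable (-π) π).congr_uIoo fun θ hθ => ?_
  rw [Set.uIoo_of_le (by linarith [Real.pi_pos])] at hθ
  exact (circleFactor_mul_eq w v ρ r hθ.1 hθ.2.le).symm

lemma unitCircleIntegral_circleFactor {w v : ℂ} (hvw : ∀ n : ℤ, v - w ≠ n) (ρ r : ℕ) :
    unitCircleIntegral (circleFactor w v ρ r) =
      2 * I * sin (π * (v - w)) * ((-1) ^ r * ((ρ ! : ℂ) * (1 / rising (v - w - r) (ρ + 1)))) := by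
  have hx := sub_natCast_ne_intCast hvw r
  have hne : ∀ j : ℕ, v - w - r + j ≠ 0 := fun j h => hx (-j) (by
    push_cast
    linear_combination h)
  rw [unitCircleIntegral, intervalIntegral.integral_congr_uIoo
    (g := fun θ : ℝ => ∑ j ∈ Finset.range (ρ + 1),
      (ρ.choose j : ℂ) * (I * exp (θ * I * (v - w - r + j)))) (fun θ hθ => by
      rw [Set.uIoo_of_le (by linarith [Real.pi_pos])] at hθ
      exact circleFactor_mul_eq w v ρ r hθ.1 hθ.2.le),
    intervalIntegral.integral_finsetSum (fun j _ => Continuous.intervalIntegrable (by fun_prop) _ _),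
    ← sum_choose_mul_one_div hx, Finset.mul_sum, Finset.mul_sum]
  refine Finset.sum_congr rfl fun j _ => ?_
  have hsin : sin (π * (v - w - r + j)) = (-1) ^ j * ((-1) ^ r * sin (π * (v - w))) := by
    rw [← sin_antiperiodic.sub_nat_mul_eq r, ← sin_antiperiodic.add_nat_mul_eq j]
    congr 1
    ring
  rw [intervalIntegral.integral_const_mul, integral_exp_mul_angle (hne j), hsin]
  ring

lemma circleIntegrand_eq (ω : Fin (M + 1) → ℂ) (ρ : Fin (M + 1) → ℕ) (m : Fin (M + 1)) (z : ℂ)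
    (t : Fin M → ℂ) :
    circleIntegrand ω ρ m z t = ∑ r ∈ Finset.range (ρ m + 1),
      ((z - 1) ^ r * ((-1) ^ M) ^ r * ((ρ m).choose r : ℂ)) *
        ∏ j, circleFactor (ω m) (ω (m.succAbove j)) (ρ (m.succAbove j)) r (t j) := by
  rw [circleIntegrand,
    show 1 - (-1) ^ M * ((1 - z) / ∏ j, t j) = (z - 1) * (-1) ^ M * (∏ j, t j)⁻¹ + 1 by ring,
    add_pow, Finset.mul_sum]
  refine Finset.sum_congr rfl fun r _ => ?_
  simp only [circleFactor, Finset.prod_mul_distrib, Finset.prod_inv_distrib, Finset.prod_pow,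
    mul_pow, inv_pow, one_pow]
  ring

lemma eval_padePoly_eq_iteratedCircleIntegral
    (hω : ∀ i j, i ≠ j → ∀ n : ℤ, ω i - ω j ≠ (n : ℂ)) (m : Fin (M + 1)) (z : ℂ) :
    (polySystem (padeCoeff ω ρ) m).eval z = Q ω m / (vecFactorial ρ : ℂ) *
      iteratedCircleIntegral M (circleIntegrand ω ρ m z) := by
  have hk : ∀ j, ∀ n : ℤ, ω (m.succAbove j) - ω m ≠ n := fun j => hω _ _ (Fin.succAbove_ne m j)
  rw [show circleIntegrand ω ρ m z = _ from funext (circleIntegrand_eq ω ρ m z),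
    iteratedCircleIntegral_sum_prod _ _ _ fun r _ j => circleIntegrableAngle_circleFactor _ _ _ _,
    eval_padePoly, Finset.mul_sum, Finset.mul_sum]
  refine Finset.sum_congr rfl fun r _ => ?_
  simp only [unitCircleIntegral_circleFactor (hk _)]
  have hsin : ∏ j, (2 * I * sin (π * (ω (m.succAbove j) - ω m))) ≠ 0 := by
    refine Finset.prod_ne_zero_iff.mpr fun j _ => mul_ne_zero (mul_ne_zero two_ne_zero I_ne_zero) ?_
    rw [Ne, sin_eq_zero_iff]
    rintro ⟨n, hn⟩
    refine hk j n (mul_left_cancel₀ (ofReal_ne_zero.mpr Real.pi_ne_zero) ?_)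
    rw [hn, mul_comm]
  have hfac : ∏ j, ((ρ (m.succAbove j))! : ℂ) ≠ 0 :=
    Finset.prod_ne_zero_iff.mpr fun j _ => by exact_mod_cast Nat.factorial_ne_zero _
  have hv : (vecFactorial ρ : ℂ) = (ρ m)! * ∏ j, ((ρ (m.succAbove j))! : ℂ) := by
    rw [vecFactorial, Fin.prod_univ_succAbove _ m]
    push_cast
    rfl
  have hsign : ((-1 : ℂ) ^ M) ^ r * ((-1 : ℂ) ^ r) ^ M = 1 := by
    rw [← pow_mul, ← pow_mul, mul_comm r M, ← mul_pow]
    simp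
  have hm : ((ρ m)! : ℂ) ≠ 0 := by exact_mod_cast Nat.factorial_ne_zero _
  rw [Q, prod_erase_eq_prod_succAbove, prod_erase_eq_prod_succAbove, Finset.prod_mul_distrib,
    Finset.prod_mul_distrib (f := fun _ : Fin M => (-1 : ℂ) ^ r),
    Finset.prod_mul_distrib (f := fun j => ((ρ (m.succAbove j))! : ℂ)), Finset.prod_const,
    Finset.card_univ, Fintype.card_fin, hv, Finset.prod_div_distrib (s := Finset.univ)
    (g := fun j => 2 * I * sin (π * (ω (m.succAbove j) - ω m))), Finset.prod_const_one]
  set R := ∏ j, 1 / rising (ω (m.succAbove j) - ω m - r) (ρ (m.succAbove j) + 1)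
  set S := ∏ j, (2 * I * sin (π * (ω (m.succAbove j) - ω m)))
  set N := ∏ j, ((ρ (m.succAbove j))! : ℂ)
  field_simp
  linear_combination (-((ρ m).choose r : ℂ) * R * (z - 1) ^ r) * hsign

end Pade

theorem theorem2p4 (M : ℕ) (ω : Fin (M + 1) → ℂ) (ρ : Fin (M + 1) → ℕ)
    (hω : ∀ i j, i ≠ j → ∀ n : ℤ, ω i - ω j ≠ (n : ℂ)) :
    -- the Padé approximants are well defined
    (∃! H : Fin (M + 1) → ℂ[X], Pade.IsPadeSystem ω ρ H) ∧
    ∀ H : Fin (M + 1) → ℂ[X], Pade.IsPadeSystem ω ρ H → ∀ m : Fin (M + 1),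
      (H m).degree = (ρ m : WithBot ℕ) ∧
      -- (i)
      (∀ (a : ℂ) (γ : Path a a), Pade.IsSimplePositiveContour γ →
        (∀ r ≤ ρ m, ω m + (r : ℂ) ∈ Pade.inside γ) →
        (∀ k, k ≠ m → ∀ r ≤ ρ k, ω k + (r : ℂ) ∈ Pade.outside γ) →
        ∀ z : ℂ, z ≠ 1 →
          (H m).eval z = (-1) ^ (Pade.sigma ρ - 1) / (2 * π * I) *
            Pade.contourIntegral (fun ξ => (1 - z) ^ (ξ - ω m) *
              ∏ k, 1 / Pade.falling (ξ - ω k) (ρ k + 1)) γ) ∧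
      -- (ii)
      (∀ z : ℂ, (H m).eval z = 1 / ((ρ m)! : ℂ) *
        ∑ r ∈ Finset.range (ρ m + 1), (z - 1) ^ r * ((ρ m).choose r : ℂ) *
          ∏ k ∈ Finset.univ.erase m, 1 / Pade.rising (ω k - ω m - r) (ρ k + 1)) ∧
      -- (iii)
      (1 ≤ M → ∀ z : ℂ, (H m).eval z = Pade.Q ω m / (Pade.vecFactorial ρ : ℂ) *
        Pade.iteratedCircleIntegral M (Pade.circleIntegrand ω ρ m z)) ∧
      -- (iv), where the hypergeometric series terminates
      (∀ z : ℂ,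
        (∀ n, ρ m < n → Pade.pFqTerm (fun k => ω m - ω k - (ρ k : ℂ))
          (fun j => 1 + ω m - ω (m.succAbove j)) (1 - z) n = 0) ∧
        (H m).eval z = 1 / ((ρ m)! : ℂ) *
          (∏ k ∈ Finset.univ.erase m, 1 / Pade.rising (ω k - ω m) (ρ k + 1)) *
          Pade.pFq (fun k => ω m - ω k - (ρ k : ℂ))
            (fun j => 1 + ω m - ω (m.succAbove j)) (1 - z)) ∧
      -- (v)
      (∀ z : ℂ, (H m).eval z = 1 / (Pade.vecFactorial ρ : ℂ) *
        ∑ r ∈ Finset.range (ρ m + 1), (z - 1) ^ r * ∏ k, Pade.gammaCoeff ω ρ m k r) := by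
  refine ⟨⟨Pade.polySystem (Pade.padeCoeff ω ρ), Pade.isPadeSystem_padeCoeff hω,
    fun K hK => hK.eq hω (Pade.isPadeSystem_padeCoeff hω)⟩, fun H hH m => ?_⟩
  obtain rfl := hH.eq hω (Pade.isPadeSystem_padeCoeff hω)
  exact ⟨Pade.degree_padePoly hω m,
    fun a γ hγ hin hout z hz => Pade.eval_padePoly_eq_contourIntegral hω m hγ hin hout hz,
    Pade.eval_padePoly ω ρ m,
    fun _ z => Pade.eval_padePoly_eq_iteratedCircleIntegral hω m z,
    fun z => ⟨fun n hn => Pade.pFqTerm_eq_zero ω ρ m (1 - z) hn,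
      Pade.eval_padePoly_eq_pFq hω m z⟩,
    Pade.eval_padePoly_eq_gammaCoeff hω m⟩
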